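/- Let $G$ be a finite group, and for $g \in G$ let $L_g$ be the matrix of the left regular representation, i.e. the complex $|G| \times |G|$ matrix with rows and columns indexed by $G$ such that $L_g e_h = e_{gh}$ for all $h \in G$. Let $\mathrm{U}(d)$ be the group of $d \times d$ complex unitary matrices. Let $\hat G$ be the set of isomorphism classes of irreducible finite-dimensional complex (unitary) representations of $G$, and for each class in $\hat G$ fix a representative $\tau : G \to \mathrm{U}(d_\tau)$ by unitary matrices, where $d_\tau$ is its dimension (the choice of representatives is arbitrary). Let $z_g \in \mathbb{C}$ for each $g \in G$. Then $\sum_{g \in G} z_g L_g$ is unitary if and only if there are unitary matrices $U_\tau \in \mathrm{U}(d_\tau)$, one for each $\tau \in \hat G$, such that for all $g \in G$ $$ z_g = \sum_{\tau \in \hat G} \frac{d_\tau}{|G|} \operatorname{Tr}\bigl(\tau(g)^\dagger U_\tau\bigr). $$ Consequently, the unitary matrices in the group algebra $\mathbb{C}[G]$, regarded as the linear span of the matrices $L_g$, are exactly the matrices $$ \sum_{g \in G} \Bigl( \sum_{\tau \in \hat G} \frac{d_\tau}{|G|} \operatorname{Tr}\bigl(\tau(g)^\dagger U_\tau\bigr)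 \Bigr) L_g $$ with $U_\tau \in \mathrm{U}(d_\tau)$ for each $\tau \in \hat G$. -/

import Mathlib

open scoped Matrix

/-- The matrix `L_g` of the left regular representation in the standard basis indexed by `G`:
it sends the basis vector `e_y` to `e_{g y}`. -/
def leftRegularMatrix {G : Type*} [Group G] [DecidableEq G] (g : G) : Matrix G G ℂ :=
  Matrix.of fun x y => if x = g * y then 1 else 0

theorem leftRegularMatrix_mulVec_single {G : Type*} [Group G] [Fintype G] [DecidableEq G]
    (g y : G) :
    leftRegularMatrix g *ᵥ Pi.single y (1 : ℂ) = Pi.single (g * y) (1 : ℂ) := by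
  ext x
  simp [leftRegularMatrix, Pi.single_apply]

/-- A `d`-dimensional unitary representation `τ : G → U(d)`, regarded as a linear representation
on `ℂ^d`. -/
noncomputable def unitaryRepToRepresentation {G : Type*} [Group G] {d : ℕ}
    (τ : G →* Matrix.unitaryGroup (Fin d) ℂ) : Representation ℂ G (Fin d → ℂ) where
  toFun g := Matrix.toLin' (τ g : Matrix (Fin d) (Fin d) ℂ)
  map_one' := by simp [Module.End.one_eq_id]
  map_mul' g h := by simp [Matrix.toLin'_mul, Module.End.mul_eq_comp]

/-- A finite-dimensional irreducible unitary matrix representation of `G`. -/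
structure UnitaryIrrep (G : Type*) [Group G] where
  /-- the dimension `d_τ` -/
  dim : ℕ
  /-- the homomorphism `τ : G → U(d_τ)` -/
  hom : G →* Matrix.unitaryGroup (Fin dim) ℂ
  irreducible : (unitaryRepToRepresentation hom).IsIrreducible

/-- The matrix `τ(g)`. -/
def UnitaryIrrep.mat {G : Type*} [Group G] (τ : UnitaryIrrep G) (g : G) :
    Matrix (Fin τ.dim) (Fin τ.dim) ℂ :=
  (τ.hom g : Matrix (Fin τ.dim) (Fin τ.dim) ℂ)

/-- Two irreducible representations are identified when they are isomorphic. -/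
instance unitaryIrrepSetoid (G : Type*) [Group G] : Setoid (UnitaryIrrep G) where
  r σ τ := Nonempty (Representation.Equiv (unitaryRepToRepresentation σ.hom)
    (unitaryRepToRepresentation τ.hom))
  iseqv :=
    { refl := fun _ => ⟨Representation.Equiv.refl _⟩
      symm := fun ⟨e⟩ => ⟨e.symm⟩
      trans := fun ⟨e⟩ ⟨f⟩ => ⟨e.trans f⟩ }

/-- The set `Ĝ` of irreducible representations of `G`, up to isomorphism. -/
def UnitaryDual (G : Type*) [Group G] : Type _ :=
  Quotient (unitaryIrrepSetoid G)

/-- The isomorphism class of an irreducible representation. -/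
def UnitaryIrrep.toDual {G : Type*} [Group G] (τ : UnitaryIrrep G) : UnitaryDual G :=
  Quotient.mk (unitaryIrrepSetoid G) τ

/-- A finite group has only finitely many irreducible representations up to isomorphism. -/
instance finite_unitaryDual (G : Type*) [Group G] [Finite G] : Finite (UnitaryDual G) := by
  classical
  have := Fintype.ofFinite G
  have hcard : (Nat.card G : ℂ) ≠ 0 := by
    simp [Nat.card_eq_fintype_card]
  let _ : Invertible (Nat.card G : ℂ) := invertibleOfNonzero hcard
  let r : UnitaryDual G → UnitaryIrrep G := Quotient.out
  have hr : ∀ x y, Nonempty (Representation.Equiv (unitaryRepToRepresentation (r x).hom)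
      (unitaryRepToRepresentation (r y).hom)) → x = y := by
    intro x y h
    rw [← Quotient.out_eq x, ← Quotient.out_eq y]
    exact Quotient.sound h
  let χ : UnitaryDual G → G → ℂ := fun x => (unitaryRepToRepresentation (r x).hom).character
  have horth : ∀ x y, (Nat.card G : ℂ)⁻¹ * ∑ g, χ x g * χ y g⁻¹ = if y = x then 1 else 0 := by
    intro x y
    have := (r x).irreducible
    have := (r y).irreducible
    rw [Representation.char_orthonormal]
    by_cases h : y = x
    · subst h
      rw [if_pos ⟨Representation.Equiv.refl _⟩, if_pos rfl]
    · rw [if_neg h, if_neg fun e => h (hr _ _ e)]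
  have hli : LinearIndependent ℂ χ := by
    rw [linearIndependent_iff']
    intro s c hc y hy
    have h1 : ∑ x ∈ s, c x * ((Nat.card G : ℂ)⁻¹ * ∑ g, χ x g * χ y g⁻¹) = 0 := by
      calc _ = (Nat.card G : ℂ)⁻¹ * ∑ g, (∑ x ∈ s, c x • χ x) g * χ y g⁻¹ := by
            simp only [Finset.sum_apply, Pi.smul_apply, smul_eq_mul, Finset.mul_sum,
              Finset.sum_mul]
            rw [Finset.sum_comm]
            refine Finset.sum_congr rfl fun g _ => Finset.sum_congr rfl fun x _ => ?_
            ring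
        _ = 0 := by rw [hc]; simp
    simp_rw [horth] at h1
    simpa [hy] using h1
  exact hli.finite

noncomputable instance fintypeUnitaryDual (G : Type*) [Group G] [Finite G] :
    Fintype (UnitaryDual G) :=
  Fintype.ofFinite _

/-! The Fourier transform `z ↦ (∑ g, z g • τ(g))_τ` is a *-isomorphism from the group algebra onto
the product of the matrix algebras over the dual, so an element is unitary exactly when each of its
components is. The stated formula for `z` is the inverse transform.

Surjectivity is Schur orthogonality of matrix coefficients (`groupAlgebraImage_inverseFourier`).
Injectivity comes from complete reducibility: an element killed by all irreducibles is killed by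
every unitary representation, in particular by the regular one, which is faithful on the group
algebra (`eq_zero_of_groupAlgebraImage_eq_zero`). Unitarity passes between the two sides because it
reads `autocorrelation z = δ₁` in any representation faithful on the group algebra
(`groupAlgebraImage_mem_unitaryGroup_iff`). -/

/-- The image `∑ g, z g • ρ g` of a group algebra element under a unitary representation. -/
noncomputable def groupAlgebraImage {G n : Type*} [Group G] [Fintype G] [Fintype n] [DecidableEq n]
    (ρ : G →* Matrix.unitaryGroup n ℂ) (z : G → ℂ) : Matrix n n ℂ :=
  ∑ g, z g • (ρ g : Matrix n n ℂ)

/-! ### Unitarity as a convolution identity -/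

section GroupAlgebraImage

variable {G n : Type*} [Group G] [Fintype n] [DecidableEq n] (ρ : G →* Matrix.unitaryGroup n ℂ)

theorem coe_map_inv_unitaryGroup (g : G) :
    ((ρ g⁻¹ : Matrix.unitaryGroup n ℂ) : Matrix n n ℂ) = (ρ g : Matrix n n ℂ)ᴴ := by
  rw [map_inv]
  rfl

variable [Fintype G]

theorem groupAlgebraImage_sub (z w : G → ℂ) :
    groupAlgebraImage ρ (z - w) = groupAlgebraImage ρ z - groupAlgebraImage ρ w := by
  simp [groupAlgebraImage, sub_smul, Finset.sum_sub_distrib]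

theorem groupAlgebraImage_single_one [DecidableEq G] :
    groupAlgebraImage ρ (Pi.single 1 1) = 1 := by
  simp [groupAlgebraImage, Pi.single_apply, ite_smul]

/-- The convolution of `z` with its adjoint `g ↦ star (z g⁻¹)`. -/
noncomputable def autocorrelation (z : G → ℂ) (k : G) : ℂ := ∑ h, z (k * h) * star (z h)

theorem groupAlgebraImage_mul_star (z : G → ℂ) :
    groupAlgebraImage ρ z * star (groupAlgebraImage ρ z) =
      groupAlgebraImage ρ (autocorrelation z) := by
  have h1 : ∀ g h : G, (ρ g : Matrix n n ℂ) * (ρ h : Matrix n n ℂ)ᴴ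
      = (ρ (g * h⁻¹) : Matrix n n ℂ) := fun g h => by
    rw [← coe_map_inv_unitaryGroup, map_mul]
    rfl
  simp only [groupAlgebraImage, star_sum, star_smul, Matrix.star_eq_conjTranspose,
    Finset.sum_mul_sum, smul_mul_smul_comm, h1, autocorrelation, Finset.sum_smul]
  -- For fixed `h`, substitute `k = g * h⁻¹`.
  refine Finset.sum_comm.trans (Eq.trans ?_ Finset.sum_comm)
  refine Finset.sum_congr rfl fun h _ => ?_
  exact Fintype.sum_equiv (Equiv.mulRight h⁻¹) _ _ fun g => by simp

/-- The function `autocorrelation z` does not depend on `ρ`, so unitarity can be compared across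
representations. -/
theorem groupAlgebraImage_mem_unitaryGroup_iff (z : G → ℂ) :
    groupAlgebraImage ρ z ∈ Matrix.unitaryGroup n ℂ ↔
      groupAlgebraImage ρ (autocorrelation z) = 1 := by
  rw [Matrix.mem_unitaryGroup_iff, groupAlgebraImage_mul_star]

end GroupAlgebraImage

/-! ### Schur's lemma and orthogonality relations -/

section Schur

variable {G : Type*} [Group G]

theorem UnitaryIrrep.mat_mul (σ : UnitaryIrrep G) (g h : G) :
    σ.mat (g * h) = σ.mat g * σ.mat h := by
  simp [UnitaryIrrep.mat]

theorem UnitaryIrrep.mat_inv (σ : UnitaryIrrep G) (g : G) : σ.mat g⁻¹ = (σ.mat g)ᴴ :=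
  coe_map_inv_unitaryGroup σ.hom g

theorem UnitaryIrrep.conjTranspose_mat_mul_mat (σ : UnitaryIrrep G) (g : G) :
    (σ.mat g)ᴴ * σ.mat g = 1 := by
  rw [← σ.mat_inv, ← σ.mat_mul, inv_mul_cancel]
  simp [UnitaryIrrep.mat]

/-- Irreducibility requires two distinct subrepresentations, which the zero space lacks. -/
theorem UnitaryIrrep.dim_ne_zero (σ : UnitaryIrrep G) : σ.dim ≠ 0 := by
  intro h
  have hs := σ.irreducible
  have : IsEmpty (Fin σ.dim) := by rw [h]; infer_instance
  obtain ⟨a, b, hab⟩ := hs.toNontrivial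
  refine hab (SetLike.ext fun v => ?_)
  rw [Subsingleton.elim v 0]
  exact ⟨fun _ => b.toSubmodule.zero_mem, fun _ => a.toSubmodule.zero_mem⟩

/-- A matrix commuting with the group actions, as an intertwining map. -/
noncomputable def matrixIntertwiningMap (σ τ : UnitaryIrrep G)
    (T : Matrix (Fin σ.dim) (Fin τ.dim) ℂ) (hT : ∀ g, σ.mat g * T = T * τ.mat g) :
    Representation.IntertwiningMap (unitaryRepToRepresentation τ.hom)
      (unitaryRepToRepresentation σ.hom) where
  toLinearMap := Matrix.toLin' T
  isIntertwining' g := by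
    change Matrix.toLin' T ∘ₗ Matrix.toLin' (τ.mat g) = Matrix.toLin' (σ.mat g) ∘ₗ Matrix.toLin' T
    rw [← Matrix.toLin'_mul, ← Matrix.toLin'_mul, hT]

/-- Schur's lemma for inequivalent representations. -/
theorem intertwining_matrix_eq_zero {σ τ : UnitaryIrrep G} (hne : σ.toDual ≠ τ.toDual)
    (T : Matrix (Fin σ.dim) (Fin τ.dim) ℂ) (hT : ∀ g, σ.mat g * T = T * τ.mat g) : T = 0 := by
  have := σ.irreducible
  have := τ.irreducible
  rcases Representation.IsIrreducible.bijective_or_eq_zero (matrixIntertwiningMap σ τ T hT)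
    with h | h
  · exact absurd (Quotient.sound
      ⟨(Representation.IntertwiningMap.ofBijective _ h)⟩ : τ.toDual = σ.toDual) hne.symm
  · have := congrArg Representation.IntertwiningMap.toLinearMap h
    exact Matrix.toLin'.injective (by simpa [matrixIntertwiningMap] using this)

/-- Schur's lemma for a single representation. -/
theorem intertwining_matrix_eq_smul_one (σ : UnitaryIrrep G)
    (T : Matrix (Fin σ.dim) (Fin σ.dim) ℂ) (hT : ∀ g, σ.mat g * T = T * σ.mat g) :
    ∃ c : ℂ, T = c • 1 := by
  have := σ.irreducible
  obtain ⟨c, hc⟩ := (Representation.IsIrreducible.algebraMap_intertwiningMap_bijective_of_isAlgClosed).2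
    (matrixIntertwiningMap σ σ T hT)
  refine ⟨c, Matrix.toLin'.injective ?_⟩
  have := congrArg Representation.IntertwiningMap.toLinearMap hc
  change _ = Matrix.toLin' T at this
  rw [← this]
  ext v
  simp

variable [Fintype G]

/-- Averaging any matrix over the group produces an intertwiner, by reindexing `g ↦ h * g`; Schur's
lemma then applies. -/
theorem mat_mul_sum_conj (σ τ : UnitaryIrrep G) (E : Matrix (Fin σ.dim) (Fin τ.dim) ℂ) (h : G) :
    σ.mat h * ∑ g, σ.mat g * E * (τ.mat g)ᴴ = (∑ g, σ.mat g * E * (τ.mat g)ᴴ) * τ.mat h := by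
  rw [Matrix.mul_sum, Matrix.sum_mul]
  refine Fintype.sum_equiv (Equiv.mulLeft h) _ _ fun g => ?_
  simp only [Equiv.coe_mulLeft, UnitaryIrrep.mat_mul, Matrix.conjTranspose_mul, Matrix.mul_assoc,
    UnitaryIrrep.conjTranspose_mat_mul_mat, Matrix.mul_one]

theorem sum_conj_eq_zero {σ τ : UnitaryIrrep G} (hne : σ.toDual ≠ τ.toDual)
    (E : Matrix (Fin σ.dim) (Fin τ.dim) ℂ) : ∑ g, σ.mat g * E * (τ.mat g)ᴴ = 0 :=
  intertwining_matrix_eq_zero hne _ (mat_mul_sum_conj σ τ E)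

theorem sum_conj_self (σ : UnitaryIrrep G) (E : Matrix (Fin σ.dim) (Fin σ.dim) ℂ) :
    ∑ g, σ.mat g * E * (σ.mat g)ᴴ = ((Fintype.card G : ℂ) / σ.dim * E.trace) • 1 := by
  obtain ⟨c, hc⟩ := intertwining_matrix_eq_smul_one σ _ (mat_mul_sum_conj σ σ E)
  have hd : (σ.dim : ℂ) ≠ 0 := Nat.cast_ne_zero.mpr σ.dim_ne_zero
  -- Conjugation preserves the trace, so `c * dim = |G| * tr E` determines `c`.
  have ht := congrArg Matrix.trace hc
  simp only [Matrix.trace_sum, Matrix.trace_smul, Matrix.trace_one, Fintype.card_fin,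
    Matrix.trace_mul_cycle, UnitaryIrrep.conjTranspose_mat_mul_mat, Matrix.one_mul,
    Finset.sum_const, Finset.card_univ, nsmul_eq_mul, smul_eq_mul] at ht
  rw [hc]
  congr 1
  field_simp
  rw [← ht]

/-- Orthogonality of matrix coefficients, for inequivalent representations. -/
theorem sum_mat_mul_star_mat_eq_zero {σ τ : UnitaryIrrep G} (hne : σ.toDual ≠ τ.toDual)
    (i j : Fin σ.dim) (k l : Fin τ.dim) :
    ∑ g, σ.mat g i j * star (τ.mat g k l) = 0 := by
  -- Averaging the matrix unit `E_{jl}` and reading entry `(i, k)` isolates this product of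
  -- coefficients.
  have := congrFun (congrFun (sum_conj_eq_zero hne (Matrix.single j l 1)) i) k
  simpa [Matrix.sum_apply, Matrix.mul_apply, Matrix.single_apply, ite_and] using this

/-- Orthogonality of matrix coefficients of a single representation. -/
theorem sum_mat_mul_star_mat_self (σ : UnitaryIrrep G) (i j k l : Fin σ.dim) :
    ∑ g, σ.mat g i j * star (σ.mat g k l) =
      if i = k ∧ j = l then (Fintype.card G : ℂ) / σ.dim else 0 := by
  have := congrFun (congrFun (sum_conj_self σ (Matrix.single j l 1)) i) k
  by_cases hjl : j = l
  · subst hjl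
    simpa [Matrix.sum_apply, Matrix.mul_apply, Matrix.single_apply, ite_and, Matrix.one_apply]
      using this
  · simpa [Matrix.sum_apply, Matrix.mul_apply, Matrix.single_apply, ite_and, Matrix.one_apply, hjl]
      using this

end Schur

/-! ### Fourier inversion: surjectivity of the transform -/

section FourierInversion

variable {G : Type*} [Group G] [Fintype G]

/-- The inverse Fourier transform of a family of matrices indexed by the dual. -/
noncomputable def inverseFourier (τ : UnitaryDual G → UnitaryIrrep G)
    (M : ∀ x, Matrix (Fin (τ x).dim) (Fin (τ x).dim) ℂ) (g : G) : ℂ :=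
  ∑ x : UnitaryDual G, ((τ x).dim : ℂ) / (Fintype.card G : ℂ) *
    Matrix.trace (((τ x).mat g)ᴴ * M x)

theorem trace_conjTranspose_mul {m : Type*} [Fintype m] (A B : Matrix m m ℂ) :
    Matrix.trace (Aᴴ * B) = ∑ k, ∑ l, star (A k l) * B k l := by
  simp only [Matrix.trace, Matrix.diag_apply, Matrix.mul_apply, Matrix.conjTranspose_apply]
  exact Finset.sum_comm

theorem sum_trace_mul_mat_eq_zero {σ τ : UnitaryIrrep G} (hne : σ.toDual ≠ τ.toDual)
    (M : Matrix (Fin τ.dim) (Fin τ.dim) ℂ) (i j : Fin σ.dim) :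
    ∑ g, Matrix.trace ((τ.mat g)ᴴ * M) * σ.mat g i j = 0 := by
  simp only [trace_conjTranspose_mul, Finset.sum_mul]
  rw [Finset.sum_comm]
  refine Finset.sum_eq_zero fun k _ => ?_
  rw [Finset.sum_comm]
  refine Finset.sum_eq_zero fun l _ => ?_
  rw [← mul_zero (M k l), ← sum_mat_mul_star_mat_eq_zero hne i j k l, Finset.mul_sum]
  exact Finset.sum_congr rfl fun g _ => by ring

theorem sum_trace_mul_mat_self (σ : UnitaryIrrep G)
    (M : Matrix (Fin σ.dim) (Fin σ.dim) ℂ) (i j : Fin σ.dim) :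
    ∑ g, Matrix.trace ((σ.mat g)ᴴ * M) * σ.mat g i j = (Fintype.card G : ℂ) / σ.dim * M i j := by
  have h : ∀ k l, ∑ g, star (σ.mat g k l) * M k l * σ.mat g i j =
      if i = k ∧ j = l then (Fintype.card G : ℂ) / σ.dim * M k l else 0 := fun k l => by
    rw [← ite_zero_mul, ← sum_mat_mul_star_mat_self, Finset.sum_mul]
    exact Finset.sum_congr rfl fun g _ => by ring
  simp only [trace_conjTranspose_mul, Finset.sum_mul]
  rw [Finset.sum_comm]
  simp_rw [Finset.sum_comm (s := (Finset.univ : Finset G)), h]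
  simp [ite_and]

/-- Orthogonality kills every class other than `x`; at `x` the factor `|G| / d` cancels the weight
`d / |G|`. -/
theorem groupAlgebraImage_inverseFourier (τ : UnitaryDual G → UnitaryIrrep G)
    (hτ : ∀ x : UnitaryDual G, (τ x).toDual = x)
    (M : ∀ x, Matrix (Fin (τ x).dim) (Fin (τ x).dim) ℂ) (x : UnitaryDual G) :
    groupAlgebraImage (τ x).hom (inverseFourier τ M) = M x := by
  classical
  ext i j
  have h1 : groupAlgebraImage (τ x).hom (inverseFourier τ M) i j =
      ∑ y, ((τ y).dim : ℂ) / (Fintype.card G : ℂ) *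
        ∑ g, Matrix.trace (((τ y).mat g)ᴴ * M y) * (τ x).mat g i j := by
    simp only [groupAlgebraImage, inverseFourier, Matrix.sum_apply, Matrix.smul_apply, smul_eq_mul,
      Finset.sum_mul, Finset.mul_sum]
    rw [Finset.sum_comm]
    exact Finset.sum_congr rfl fun y _ => Finset.sum_congr rfl fun g _ => mul_assoc _ _ _
  have hd : ((τ x).dim : ℂ) ≠ 0 := Nat.cast_ne_zero.mpr (τ x).dim_ne_zero
  have hG : (Fintype.card G : ℂ) ≠ 0 := Nat.cast_ne_zero.mpr Fintype.card_ne_zero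
  rw [h1, Finset.sum_eq_single x, sum_trace_mul_mat_self]
  · field_simp
  · intro y _ hy
    rw [sum_trace_mul_mat_eq_zero (by rw [hτ, hτ]; exact hy.symm), mul_zero]
  · simp

end FourierInversion

/-! ### Complete reducibility of unitary representations -/

section Injectivity

variable {G : Type*} [Group G]

theorem isIrreducible_of_equiv {V W : Type*} [AddCommGroup V] [Module ℂ V] [AddCommGroup W]
    [Module ℂ W] {ρ : Representation ℂ G V} {σ : Representation ℂ G W}
    (e : Representation.Equiv ρ σ) (h : ρ.IsIrreducible) : σ.IsIrreducible := by
  have hsurj : Function.Surjective e.toLinearEquiv := e.toLinearEquiv.surjective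
  have he : ∀ g v, e.toLinearEquiv (ρ g v) = σ g (e.toLinearEquiv v) := fun g v =>
    e.toIntertwiningMap.isIntertwining _ _ g v
  let c : Subrepresentation σ → Subrepresentation ρ := fun S =>
    ⟨S.toSubmodule.comap e.toLinearEquiv.toLinearMap, fun g v hv => by
      change e.toLinearEquiv (ρ g v) ∈ S.toSubmodule
      rw [he]
      exact S.apply_mem_toSubmodule g hv⟩
  have hc : ∀ S v, v ∈ c S ↔ e.toLinearEquiv v ∈ S := fun S v => Iff.rfl
  have hinj : Function.Injective c := fun S T hST => SetLike.ext fun w => by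
    obtain ⟨v, rfl⟩ := hsurj w
    rw [← hc, ← hc, hST]
  have htop : c ⊤ = ⊤ := rfl
  have hbot : c ⊥ = ⊥ := SetLike.ext fun v => e.toLinearEquiv.map_eq_zero_iff
  exact
    { exists_pair_ne := ⟨⊥, ⊤, fun hbt => bot_ne_top (hbot.symm.trans ((congrArg c hbt).trans htop))⟩
      eq_bot_or_eq_top := fun S => (eq_bot_or_eq_top (c S)).imp
        (fun h => hinj (h.trans hbot.symm)) fun h => hinj (h.trans htop.symm) }

variable [Fintype G]

theorem toLin'_groupAlgebraImage {d : ℕ} (ρ : G →* Matrix.unitaryGroup (Fin d) ℂ) (z : G → ℂ) :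
    Matrix.toLin' (groupAlgebraImage ρ z) = ∑ g, z g • unitaryRepToRepresentation ρ g := by
  simp [groupAlgebraImage, unitaryRepToRepresentation]

theorem sum_smul_eq_zero_of_equiv {V W : Type*} [AddCommGroup V] [Module ℂ V] [AddCommGroup W]
    [Module ℂ W] {ρ : Representation ℂ G V} {σ : Representation ℂ G W}
    (e : Representation.Equiv ρ σ) {z : G → ℂ} (h : ∑ g, z g • σ g = 0) :
    ∑ g, z g • ρ g = 0 := by
  ext v
  apply e.toLinearEquiv.injective
  have he : ∀ g, e.toLinearEquiv (ρ g v) = σ g (e.toLinearEquiv v) := fun g =>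
    e.toIntertwiningMap.isIntertwining _ _ g v
  have := LinearMap.congr_fun h (e.toLinearEquiv v)
  simpa [he] using this

variable {E : Type*} [NormedAddCommGroup E] [InnerProductSpace ℂ E] [FiniteDimensional ℂ E]

/-- The matrices of a unitary representation in an orthonormal basis. -/
noncomputable def unitaryMatrixRep (ρ : Representation ℂ G E)
    (hρ : ∀ g v w, inner ℂ (ρ g v) (ρ g w) = inner ℂ v w) {d : ℕ}
    (b : OrthonormalBasis (Fin d) ℂ E) : G →* Matrix.unitaryGroup (Fin d) ℂ where
  toFun g := ⟨LinearMap.toMatrix b.toBasis b.toBasis (ρ g), by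
    rw [Matrix.mem_unitaryGroup_iff']
    ext i j
    simp only [Matrix.star_eq_conjTranspose, Matrix.mul_apply, Matrix.conjTranspose_apply,
      LinearMap.toMatrix_apply, OrthonormalBasis.coe_toBasis, OrthonormalBasis.coe_toBasis_repr_apply,
      OrthonormalBasis.repr_apply_apply, RCLike.star_def, inner_conj_symm]
    rw [b.sum_inner_mul_inner, hρ, orthonormal_iff_ite.mp b.orthonormal, Matrix.one_apply]⟩
  map_one' := by
    ext1
    simp
  map_mul' g h := by
    ext1
    simp [LinearMap.toMatrix_mul]

/-- A unitary representation is equivalent to its matrix form. -/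
noncomputable def unitaryMatrixRepEquiv (ρ : Representation ℂ G E)
    (hρ : ∀ g v w, inner ℂ (ρ g v) (ρ g w) = inner ℂ v w) {d : ℕ}
    (b : OrthonormalBasis (Fin d) ℂ E) :
    Representation.Equiv ρ (unitaryRepToRepresentation (unitaryMatrixRep ρ hρ b)) :=
  Representation.Equiv.mk b.toBasis.equivFun fun g => by
    ext v i
    have := congrFun (LinearMap.toMatrix_mulVec_repr b.toBasis b.toBasis (ρ g) v) i
    exact this.symm

/-- The orthogonal complement of a subrepresentation of a unitary representation. -/
noncomputable def orthogonalSubrepresentation {ρ : Representation ℂ G E}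
    (hρ : ∀ g v w, inner ℂ (ρ g v) (ρ g w) = inner ℂ v w) (S : Subrepresentation ρ) :
    Subrepresentation ρ where
  toSubmodule := S.toSubmoduleᗮ
  apply_mem_toSubmodule g v hv := by
    rw [Submodule.mem_orthogonal] at hv ⊢
    intro u hu
    rw [← hρ g⁻¹, Representation.inv_self_apply]
    exact hv _ (S.apply_mem_toSubmodule g⁻¹ hu)

theorem sum_smul_subrepresentation_apply {V : Type*} [AddCommGroup V] [Module ℂ V]
    {ρ : Representation ℂ G V} (S : Subrepresentation ρ) {z : G → ℂ}
    (h : ∑ g, z g • S.toRepresentation g = 0) {v : V} (hv : v ∈ S.toSubmodule) :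
    (∑ g, z g • ρ g) v = 0 := by
  have := congrArg Subtype.val (LinearMap.congr_fun h ⟨v, hv⟩)
  simpa [Subrepresentation.toRepresentation] using this

/-- A group algebra element killed by all irreducible representations is killed by every unitary
representation. -/
theorem sum_smul_unitary_eq_zero {z : G → ℂ}
    (hz : ∀ σ : UnitaryIrrep G, groupAlgebraImage σ.hom z = 0) (N : ℕ) :
    ∀ {E : Type*} [NormedAddCommGroup E] [InnerProductSpace ℂ E] [FiniteDimensional ℂ E]
      (ρ : Representation ℂ G E), (∀ g v w, inner ℂ (ρ g v) (ρ g w) = inner ℂ v w) →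
      Module.finrank ℂ E = N → ∑ g, z g • ρ g = 0 := by
  -- Induction on dimension, with the space left free so that the hypothesis applies to proper
  -- subrepresentations.
  induction N using Nat.strong_induction_on with
  | _ N ih =>
  intro E _ _ _ ρ hρ hN
  by_cases hirr : ρ.IsIrreducible
  · let b := stdOrthonormalBasis ℂ E
    have e := unitaryMatrixRepEquiv ρ hρ b
    refine sum_smul_eq_zero_of_equiv e ?_
    have := hz ⟨_, unitaryMatrixRep ρ hρ b, isIrreducible_of_equiv e hirr⟩
    rw [← toLin'_groupAlgebraImage, this, map_zero]
  -- The zero space is not irreducible, yet has no proper splitting, so it is treated apart.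
  · rcases subsingleton_or_nontrivial E with hE | hE
    · exact Subsingleton.elim _ _
    have hnt : Nontrivial (Subrepresentation ρ) := by
      refine ⟨⊥, ⊤, fun h => ?_⟩
      obtain ⟨v, hv⟩ := exists_ne (0 : E)
      exact hv (show v ∈ (⊥ : Subrepresentation ρ) from h ▸ (Submodule.mem_top : v ∈ (⊤ : Submodule ℂ E)))
    obtain ⟨S, hS⟩ : ∃ S : Subrepresentation ρ, ¬(S = ⊥ ∨ S = ⊤) := by
      by_contra! h
      exact hirr { eq_bot_or_eq_top := fun S => (h S).elim (by tauto) (by tauto) }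
    push Not at hS
    have hSb : S.toSubmodule ≠ ⊥ := fun h =>
      hS.1 (Subrepresentation.toSubmodule_injective h)
    have hSt : S.toSubmodule ≠ ⊤ := fun h =>
      hS.2 (Subrepresentation.toSubmodule_injective h)
    have hvanish : ∀ T : Subrepresentation ρ, T.toSubmodule ≠ ⊤ →
        ∑ g, z g • T.toRepresentation g = 0 := fun T hT =>
      ih _ (hN ▸ Submodule.finrank_lt hT) T.toRepresentation
        (fun g v w => hρ g v w) rfl
    ext v
    -- Both summands are invariant and proper: `S ≠ ⊤`, and the complement is `⊤` only when `S = ⊥`.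
    have hv : v ∈ S.toSubmodule ⊔ S.toSubmoduleᗮ := by
      rw [Submodule.sup_orthogonal_of_hasOrthogonalProjection]
      exact Submodule.mem_top
    obtain ⟨s, hs, t, ht, rfl⟩ := Submodule.mem_sup.mp hv
    have h1 := sum_smul_subrepresentation_apply S (hvanish S hSt) hs
    have h2 := sum_smul_subrepresentation_apply (orthogonalSubrepresentation hρ S)
      (hvanish _ fun h => hSb ((Submodule.orthogonal_eq_top_iff _).mp h)) ht
    rw [map_add, h1, h2, add_zero, LinearMap.zero_apply]

end Injectivity

/-! ### The regular representation and the unitarity criterion -/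

section Regular

variable {G : Type*} [Group G]

/-- The left regular representation on functions, with its Euclidean inner product. -/
noncomputable def regularUnitaryRep (G : Type*) [Group G] :
    Representation ℂ G (EuclideanSpace ℂ G) where
  toFun g :=
    { toFun := fun v => WithLp.toLp 2 fun x => v (g⁻¹ * x)
      map_add' := fun _ _ => rfl
      map_smul' := fun _ _ => rfl }
  map_one' := by ext v x; simp
  map_mul' g h := by
    ext v x
    change v _ = v _
    rw [mul_inv_rev, mul_assoc]

theorem regularUnitaryRep_apply (g x : G) (v : EuclideanSpace ℂ G) :
    regularUnitaryRep G g v x = v (g⁻¹ * x) :=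
  rfl

variable [Fintype G]

theorem inner_regularUnitaryRep (g : G) (v w : EuclideanSpace ℂ G) :
    inner ℂ (regularUnitaryRep G g v) (regularUnitaryRep G g w) = inner ℂ v w := by
  simp only [PiLp.inner_apply]
  exact Fintype.sum_equiv (Equiv.mulLeft g⁻¹) _ _ fun x => rfl

/-- A group algebra element killed by all irreducible representations is zero. -/
theorem eq_zero_of_groupAlgebraImage_eq_zero {z : G → ℂ}
    (hz : ∀ σ : UnitaryIrrep G, groupAlgebraImage σ.hom z = 0) : z = 0 := by
  classical
  have h := sum_smul_unitary_eq_zero hz _ (regularUnitaryRep G) inner_regularUnitaryRep rfl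
  ext x
  -- Applied to `e_1`, the operator gives `∑ g, z g • e_g`, whose value at `x` is `z x`.
  have := congrArg (fun v : EuclideanSpace ℂ G => v x)
    (LinearMap.congr_fun h (EuclideanSpace.single 1 1))
  simpa [regularUnitaryRep_apply, inv_mul_eq_one] using this

theorem groupAlgebraImage_eq_zero_of_toDual_eq {σ τ : UnitaryIrrep G} (h : σ.toDual = τ.toDual)
    {z : G → ℂ} (hz : groupAlgebraImage τ.hom z = 0) : groupAlgebraImage σ.hom z = 0 := by
  obtain ⟨e⟩ : Nonempty (Representation.Equiv (unitaryRepToRepresentation σ.hom)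
    (unitaryRepToRepresentation τ.hom)) := Quotient.exact h
  apply Matrix.toLin'.injective
  rw [map_zero, toLin'_groupAlgebraImage]
  refine sum_smul_eq_zero_of_equiv e ?_
  rw [← toLin'_groupAlgebraImage, hz, map_zero]

/-- The Fourier transform is injective. -/
theorem eq_of_groupAlgebraImage_eq (τ : UnitaryDual G → UnitaryIrrep G)
    (hτ : ∀ x : UnitaryDual G, (τ x).toDual = x) {z w : G → ℂ}
    (h : ∀ x, groupAlgebraImage (τ x).hom z = groupAlgebraImage (τ x).hom w) : z = w := by
  rw [← sub_eq_zero]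
  refine eq_zero_of_groupAlgebraImage_eq_zero fun σ => ?_
  refine groupAlgebraImage_eq_zero_of_toDual_eq (hτ σ.toDual).symm ?_
  rw [groupAlgebraImage_sub, h, sub_self]

variable [DecidableEq G]

/-- The left regular representation as a homomorphism to the unitary group. -/
noncomputable def leftRegularHom (G : Type*) [Group G] [Fintype G] [DecidableEq G] :
    G →* Matrix.unitaryGroup G ℂ where
  toFun g := ⟨leftRegularMatrix g, by
    rw [Matrix.mem_unitaryGroup_iff]
    ext x y
    simp [Matrix.mul_apply, leftRegularMatrix, Matrix.one_apply, ← inv_mul_eq_iff_eq_mul,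
      eq_comm (a := x)]⟩
  map_one' := by
    ext x y
    simp [leftRegularMatrix, Matrix.one_apply]
  map_mul' g h := by
    ext x y
    simp [leftRegularMatrix, Matrix.mul_apply, mul_assoc]

/-- Since `L_g e_1 = e_g`, the column indexed by `1` recovers `z`; hence the `L_g` are linearly
independent. -/
theorem groupAlgebraImage_leftRegularHom_apply_one (z : G → ℂ) (g : G) :
    groupAlgebraImage (leftRegularHom G) z g 1 = z g := by
  simp [groupAlgebraImage, leftRegularHom, leftRegularMatrix, Matrix.sum_apply]

theorem groupAlgebraImage_leftRegularHom_injective :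
    Function.Injective (groupAlgebraImage (leftRegularHom G)) := fun z w h => by
  ext g
  rw [← groupAlgebraImage_leftRegularHom_apply_one z, h,
    groupAlgebraImage_leftRegularHom_apply_one]

/-- Both sides say that `autocorrelation z` is `δ₁`: one by faithfulness of the regular
representation, the other by injectivity of the Fourier transform. -/
theorem groupAlgebraImage_leftRegularHom_mem_unitaryGroup_iff
    (τ : UnitaryDual G → UnitaryIrrep G) (hτ : ∀ x : UnitaryDual G, (τ x).toDual = x)
    (z : G → ℂ) :
    groupAlgebraImage (leftRegularHom G) z ∈ Matrix.unitaryGroup G ℂ ↔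
      ∀ x, groupAlgebraImage (τ x).hom z ∈ Matrix.unitaryGroup (Fin (τ x).dim) ℂ := by
  simp only [groupAlgebraImage_mem_unitaryGroup_iff]
  constructor
  · intro h x
    rw [groupAlgebraImage_leftRegularHom_injective (h.trans (groupAlgebraImage_single_one _).symm),
      groupAlgebraImage_single_one]
  · intro h
    rw [eq_of_groupAlgebraImage_eq τ hτ (w := Pi.single 1 1)
      fun x => (h x).trans (groupAlgebraImage_single_one _).symm, groupAlgebraImage_single_one]

theorem sum_smul_leftRegularMatrix_mem_unitaryGroup_iff
    (τ : UnitaryDual G → UnitaryIrrep G) (hτ : ∀ x : UnitaryDual G, (τ x).toDual = x)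
    (z : G → ℂ) :
    (∑ g : G, z g • leftRegularMatrix g) ∈ Matrix.unitaryGroup G ℂ ↔
      ∃ U : ∀ x : UnitaryDual G, Matrix.unitaryGroup (Fin (τ x).dim) ℂ,
        ∀ g : G, z g = inverseFourier τ (fun x => (U x : Matrix _ _ ℂ)) g := by
  refine (groupAlgebraImage_leftRegularHom_mem_unitaryGroup_iff τ hτ z).trans ⟨fun h => ?_, ?_⟩
  -- The witness `U x` is the Fourier component of `z` at `x`; both functions have the same
  -- transform.
  · refine ⟨fun x => ⟨_, h x⟩, congrFun ?_⟩
    exact eq_of_groupAlgebraImage_eq τ hτ fun x =>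
      (groupAlgebraImage_inverseFourier τ hτ (fun x => groupAlgebraImage (τ x).hom z) x).symm
  · rintro ⟨U, hU⟩ x
    rw [funext hU, groupAlgebraImage_inverseFourier τ hτ]
    exact (U x).2

end Regular

theorem mainTheorem1 {G : Type*} [Group G] [Fintype G] [DecidableEq G]
    (τ : UnitaryDual G → UnitaryIrrep G) (hτ : ∀ x : UnitaryDual G, (τ x).toDual = x) :
    (∀ z : G → ℂ,
      (∑ g : G, z g • leftRegularMatrix g) ∈ Matrix.unitaryGroup G ℂ ↔
        ∃ U : ∀ x : UnitaryDual G, Matrix.unitaryGroup (Fin (τ x).dim) ℂ, ∀ g : G,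
          z g = ∑ x : UnitaryDual G, ((τ x).dim : ℂ) / (Fintype.card G : ℂ) *
            Matrix.trace (((τ x).mat g)ᴴ * (U x : Matrix (Fin (τ x).dim) (Fin (τ x).dim) ℂ))) ∧
    (Submodule.span ℂ (Set.range (leftRegularMatrix : G → Matrix G G ℂ)) : Set (Matrix G G ℂ)) ∩
        (Matrix.unitaryGroup G ℂ : Set (Matrix G G ℂ)) =
      {A | ∃ U : ∀ x : UnitaryDual G, Matrix.unitaryGroup (Fin (τ x).dim) ℂ,
        A = ∑ g : G, (∑ x : UnitaryDual G, ((τ x).dim : ℂ) / (Fintype.card G : ℂ) *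
            Matrix.trace (((τ x).mat g)ᴴ * (U x : Matrix (Fin (τ x).dim) (Fin (τ x).dim) ℂ))) •
          leftRegularMatrix g} := by
  have key := sum_smul_leftRegularMatrix_mem_unitaryGroup_iff τ hτ
  refine ⟨key, Set.ext fun A => ⟨?_, ?_⟩⟩
  · rintro ⟨hA, hU⟩
    obtain ⟨z, rfl⟩ := (Submodule.mem_span_range_iff_exists_fun ℂ).mp hA
    obtain ⟨U, hz⟩ := (key z).mp hU
    exact ⟨U, Finset.sum_congr rfl fun g _ => by rw [hz g]; rfl⟩
  · rintro ⟨U, rfl⟩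
    exact ⟨(Submodule.mem_span_range_iff_exists_fun ℂ).mpr ⟨_, rfl⟩,
      (key _).mpr ⟨U, fun g => rfl⟩⟩
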